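/- Let $n\ge 1$ and $m\ge 0$ be integers of the same parity. For a partition $\mu$ let $m_i(\mu)$ be the number of parts of $\mu$ equal to $i$, and let its length be its number of (positive) parts. The cycle-type of a permutation in $\mathfrak S_n$ is the partition of $n$ formed by the lengths of all its cycles, fixed points included. Let $z_\mu$ be the number of permutations of cycle-type $\mu$, and for $\mu\vdash n$ let $p^{(n)}_\mu$ be the number of ordered pairs of $n$-cycles in $\mathfrak S_n$ whose product has cycle-type $\mu$. For $\lambda\vdash n+1$ and $i>0$ such that $i+1$ is a part of $\lambda$, let $\lambda^{\downarrow(i+1)}\vdash n$ be obtained from $\lambda$ by changing one part $i+1$ into a part $i$. (a) For every partition $\lambda\vdash n+1$ of length $m$, $$\frac{n+1}{2}\sum_{i>0,\; m_{i+1}(\lambda)\neq 0} i\, m_i\bigl(\lambda^{\downarrow(i+1)}\bigr)\, p^{(n)}_{\lambda^{\downarrow(i+1)}} = (n-1)!\, z_\lambda .$$ (b) Consequently (by summing over all $\lambda\vdash n+1$ of length $m$) the Zagier–Stanley formula holds: the number of $n$-cycles $s\in\mathfrak S_n$ such that the product $(1\;2\;\cdots\;n)\,s$ has exactly $m$ cycles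 is $$\frac{2}{n(n+1)}\,C(n+1,m),$$ where $C(n+1,m)$ is the signless Stirling number of the first kind, i.e. the number of permutations of $n+1$ letters with exactly $m$ cycles. -/

import Mathlib

/-- The cycle-type of a permutation of an `n`-element set, as a partition of `n`
(fixed points are counted as parts equal to `1`). -/
def cyclePartition {n : ℕ} (σ : Equiv.Perm (Fin n)) : n.Partition where
  parts := σ.partition.parts
  parts_pos h := σ.partition.parts_pos h
  parts_sum := by rw [σ.partition.parts_sum, Fintype.card_fin]

/-- The multiplicity `m_i(μ)` of the part `i` in the partition `μ`. -/
def partMult {n : ℕ} (μ : n.Partition) (i : ℕ) : ℕ := μ.parts.count i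

/-- The length of a partition: its number of (positive) parts. -/
def partLength {n : ℕ} (μ : n.Partition) : ℕ := Multiset.card μ.parts

/-- `z_μ`: the number of permutations of cycle-type `μ`. -/
def numOfType {n : ℕ} (μ : n.Partition) : ℕ :=
  (Finset.univ.filter fun σ : Equiv.Perm (Fin n) => cyclePartition σ = μ).card

/-- An `n`-cycle in the symmetric group on `n` letters: all letters lie in one cycle
(for `n = 1` this is the identity). -/
def IsLongCycle {n : ℕ} (σ : Equiv.Perm (Fin n)) : Prop := (cyclePartition σ).parts = {n}

instance {n : ℕ} : DecidablePred (IsLongCycle (n := n)) := fun σ =>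
  inferInstanceAs (Decidable ((cyclePartition σ).parts = {n}))

/-- `p^{(n)}_μ`: the number of ordered pairs of `n`-cycles whose product has cycle-type `μ`. -/
def numLongPairs {n : ℕ} (μ : n.Partition) : ℕ :=
  (Finset.univ.filter fun st : Equiv.Perm (Fin n) × Equiv.Perm (Fin n) =>
    IsLongCycle st.1 ∧ IsLongCycle st.2 ∧ cyclePartition (st.1 * st.2) = μ).card

/-- The indices `i > 0` such that `i + 1` is a part of the given partition of `n + 1`. -/
def lowerIndices {n : ℕ} (lam : (n + 1).Partition) : Finset ℕ :=
  (Finset.Icc 1 n).filter fun i => i + 1 ∈ lam.parts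

/-- The partition of `n` obtained from a partition of `n + 1` by changing one part `i + 1`
into a part `i`, where `i > 0`. -/
def lowerPart {n : ℕ} (lam : (n + 1).Partition) (i : ℕ) (hi : i ∈ lowerIndices lam) :
    n.Partition where
  parts := i ::ₘ lam.parts.erase (i + 1)
  parts_pos := by
    intro j hj
    rcases Multiset.mem_cons.1 hj with rfl | hj
    · exact (Finset.mem_Icc.1 (Finset.mem_filter.1 hi).1).1
    · exact lam.parts_pos (Multiset.mem_of_mem_erase hj)
  parts_sum := by
    have h := Multiset.sum_erase (Finset.mem_filter.1 hi).2
    rw [lam.parts_sum] at h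
    rw [Multiset.sum_cons]
    omega

/-- `C(n, k)`: the signless Stirling number of the first kind, that is, the number of
permutations of `n` letters with exactly `k` cycles (fixed points included). -/
def numWithCycles (n k : ℕ) : ℕ :=
  (Finset.univ.filter fun σ : Equiv.Perm (Fin n) => partLength (cyclePartition σ) = k).card

/-! ### Full cycles and near-cycles -/

open Equiv Finset

/-! Mark a letter `y` in a pair of `n`-cycles `s`, `t`, and insert a new letter 0 before `y` in the
cycle of `s * t`. A cycle of length `i` then becomes one of length `i + 1`. For fixed `lam`, the `i
* m_i` choices of `y` on the `i`-cycles of a product of type `lowerPart lam i` therefore make the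
sum in (a) the number of marked pairs whose enlarged product has type `lam` (`sum_lowerPart`).

The enlarged product factors as `fixZero s * insertZero t (s⁻¹ y)`, so marked pairs are
factorizations on `n + 1` letters into an `n`-cycle fixing 0 and an `(n + 1)`-cycle
(`card_markedLongPairs`). By conjugation, allowing any fixed point multiplies their number by `n +
1`. The parity hypothesis makes permutations of type `lam` odd, so (a) reduces to the claim that
every odd `u` has exactly `2 (n - 1)!` factorizations with arbitrary fixed point
(`card_factorizations`).

For the claim, write `N = n + 1`, and let `M` be the number of near-cycles with a given fixed point.
By a matrix-tree argument, the indicator that `g` is a full cycle is a cofactor of `I - P`, with `P`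
the permutation matrix of `g`; this is an alternating sum of principal minors over sets `J` avoiding
a letter (`sum_minorDet_perm`). Put `g = s⁻¹ * u` and sum over near-cycles `s`. Minors of size 2 to
`N - 2` cancel (`sum_minorDet_eq_zero`); sizes 0, 1 and `N - 1` give `N M - (N - 1) M - sign(u) M =
M (1 - sign u)`.

Part (b) follows by summing over `lam`: insertion preserves the number of cycles, and all `n`-cycles
are conjugate. -/

/-- A permutation with no proper nonempty closed subset, i.e. with a single orbit. -/
def IsFullCycle {α : Type*} [Fintype α] (g : Perm α) : Prop :=
  ∀ J : Finset α, J.Nonempty → (∀ y ∈ J, g y ∈ J) → J = univ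

/-- `s` fixes `a` and has a single orbit on the complement of `a`. -/
def IsNearCycle {α : Type*} [Fintype α] [DecidableEq α] (s : Perm α) (a : α) : Prop :=
  s a = a ∧ ∀ J : Finset α, a ∉ J → J.Nonempty → (∀ y ∈ J, s y ∈ J) → J = univ.erase a

theorem closed_conj {α : Type*} {g τ : Perm α} {J : Finset α} (hc : ∀ y ∈ J, (τ * g * τ⁻¹) y ∈ J) :
    ∀ y ∈ J.map τ.symm.toEmbedding, g y ∈ J.map τ.symm.toEmbedding := by
  intro y hy
  rw [mem_map_equiv] at hy ⊢
  simpa using hc _ hy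

theorem IsFullCycle.conj {α : Type*} [Fintype α] {g : Perm α} (h : IsFullCycle g) (τ : Perm α) :
    IsFullCycle (τ * g * τ⁻¹) := by
  intro J hJ hc
  have := h _ (hJ.map (f := τ.symm.toEmbedding)) (closed_conj hc)
  ext y
  have hy : τ⁻¹ y ∈ J.map τ.symm.toEmbedding := this ▸ mem_univ _
  rw [mem_map_equiv] at hy
  simpa using hy

section
variable {α : Type*} [Fintype α] [DecidableEq α]

/-- The swap inserts the fixed point `a` just before `b` in the long cycle. -/
theorem IsNearCycle.swap_mul {s : Perm α} {a b : α} (h : IsNearCycle s a) (hab : b ≠ a) :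
    IsFullCycle (swap a b * s) := by
  intro J hJ hc
  have ha := h.1
  have hTa : (swap a b * s) a = b := by simp [ha]
  have hTb : (swap a b * s) (s⁻¹ b) = a := by simp
  have key : J.erase a = univ.erase a := by
    refine h.2 _ (by simp) ?_ ?_
    · obtain ⟨z, hz⟩ := hJ
      by_cases hza : z = a
      · subst hza
        exact ⟨b, mem_erase.2 ⟨hab, hTa ▸ hc _ hz⟩⟩
      · exact ⟨z, mem_erase.2 ⟨hza, hz⟩⟩
    · intro y hy
      obtain ⟨hya, hyJ⟩ := mem_erase.1 hy
      have hsa : s y ≠ a := fun e => hya (s.injective (e.trans ha.symm))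
      refine mem_erase.2 ⟨hsa, ?_⟩
      have h1 := hc y hyJ
      by_cases hb : s y = b
      · have : a ∈ J := by simpa [hb] using h1
        rw [hb]
        exact hTa ▸ hc _ this
      · simpa [swap_apply_of_ne_of_ne hsa hb] using h1
  have hmem : ∀ z, z ≠ a → z ∈ J := fun z hz =>
    mem_of_mem_erase (key ▸ mem_erase.2 ⟨hz, mem_univ z⟩)
  have hsb : s⁻¹ b ≠ a := fun e => hab (by rw [← ha, ← e]; simp)
  ext z
  simp only [mem_univ, iff_true]
  by_cases hz : z = a
  · rw [hz, ← hTb]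
    exact hc _ (hmem _ hsb)
  · exact hmem z hz

/-- The swap cuts `q` out of the cycle: the preimage of `q` is now sent to `T q`. -/
theorem IsFullCycle.swap_mul {T : Perm α} (h : IsFullCycle T) (q : α) :
    IsNearCycle (swap q (T q) * T) q := by
  refine ⟨by simp, fun J hq hJ hc => ?_⟩
  have hstep : ∀ y ∈ J, T y = q ∨ T y ∈ J := by
    intro y hy
    by_cases h1 : T y = q
    · exact Or.inl h1
    · have h2 : T y ≠ T q := fun e => hq (T.injective e ▸ hy)
      exact Or.inr (by simpa [swap_apply_of_ne_of_ne h1 h2] using hc y hy)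
  by_cases hex : ∃ y ∈ J, T y = q
  · obtain ⟨y, hy, hyq⟩ := hex
    have hTq : T q ∈ J := by simpa [hyq] using hc y hy
    have := h (insert q J) ⟨q, by simp⟩ (by
      intro z hz
      rcases mem_insert.1 hz with rfl | hz
      · exact mem_insert_of_mem hTq
      · exact mem_insert.2 (hstep z hz))
    rw [← this, erase_insert hq]
  · have := h J hJ fun y hy => (hstep y hy).resolve_left fun e => hex ⟨y, hy, e⟩
    exact absurd (this ▸ mem_univ q) hq

theorem isFullCycle_iff_sameCycle (g : Perm α) : IsFullCycle g ↔ ∀ x y, g.SameCycle x y := by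
  constructor
  · intro h x y
    have := h (univ.filter fun z => g.SameCycle x z) ⟨x, by simp [Perm.SameCycle.refl]⟩ (by simp)
    have hy : y ∈ univ.filter fun z => g.SameCycle x z := by rw [this]; exact mem_univ y
    simpa using hy
  · intro h J hJ hc
    obtain ⟨x, hx⟩ := hJ
    ext y
    simp only [mem_univ, iff_true]
    obtain ⟨i, -, hi⟩ := (h x y).exists_pow_eq'
    have : ∀ k : ℕ, (g ^ k) x ∈ J := by
      intro k
      induction k with
      | zero => simpa
      | succ k ih => rw [pow_succ']; exact hc _ ih
    exact hi ▸ this i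

theorem IsNearCycle.conj {s : Perm α} {a : α} (h : IsNearCycle s a) (τ : Perm α) :
    IsNearCycle (τ * s * τ⁻¹) (τ a) := by
  refine ⟨by simp [h.1], fun J ha hJ hc => ?_⟩
  have := h.2 _ (by rw [mem_map_equiv]; simpa using ha) (hJ.map (f := τ.symm.toEmbedding))
    (closed_conj hc)
  ext y
  have hy : τ⁻¹ y ∈ J.map τ.symm.toEmbedding ↔ τ⁻¹ y ∈ univ.erase a := by rw [this]
  rw [mem_map_equiv] at hy
  simpa [Equiv.symm_apply_eq] using hy

theorem IsFullCycle.isCycle [Nontrivial α] {g : Perm α} (h : IsFullCycle g) :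
    g.IsCycle ∧ g.support = univ := by
  have hne : ∀ x, g x ≠ x := by
    intro x hx
    have := h {x} (by simp) (by simpa using hx)
    obtain ⟨y, hy⟩ := exists_ne x
    exact hy (mem_singleton.1 (this ▸ mem_univ y))
  obtain ⟨x⟩ : Nonempty α := inferInstance
  refine ⟨⟨x, hne x, fun y _ => (isFullCycle_iff_sameCycle g).1 h x y⟩, ?_⟩
  ext y
  simpa using hne y

theorem IsFullCycle.sign [Nontrivial α] {g : Perm α} (h : IsFullCycle g) :
    Perm.sign g = -(-1) ^ Fintype.card α := by
  rw [h.isCycle.1.sign, h.isCycle.2, card_univ]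

theorem IsNearCycle.sign [Nontrivial α] {s : Perm α} {a : α} (h : IsNearCycle s a) :
    Perm.sign s = (-1) ^ Fintype.card α := by
  obtain ⟨b, hb⟩ := exists_ne a
  have := (h.swap_mul hb).sign
  rw [Perm.sign_mul, Perm.sign_swap hb.symm, neg_one_mul] at this
  exact neg_injective this

end

/-! ### Principal minors and the indicator of full cycles -/

/-- The determinant of the matrix whose row `i` is the basis vector at `f i` for `i ∈ J`
and at `i` for `i ∉ J`. -/
def minorDet {α : Type*} [Fintype α] [DecidableEq α] (J : Finset α) (f : α → α) : ℤ :=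
  Matrix.det (Matrix.of fun i j => if (if i ∈ J then f i else i) = j then (1 : ℤ) else 0)

section
variable {α : Type*} [Fintype α] [DecidableEq α]

theorem minorDet_congr {J : Finset α} {f g : α → α} (h : ∀ i ∈ J, f i = g i) :
    minorDet J f = minorDet J g := by
  unfold minorDet
  congr 1
  ext i j
  by_cases hi : i ∈ J <;> simp [hi, h]

/-- Row `f i` lies outside `J`, so it is a unit row, and it equals row `i`. -/
theorem minorDet_eq_zero {J : Finset α} {f : α → α} {i : α} (hi : i ∈ J) (hf : f i ∉ J) :
    minorDet J f = 0 := by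
  refine Matrix.det_zero_of_row_eq (i := i) (j := f i) (fun e => hf (e ▸ hi)) ?_
  ext j
  simp [hi, hf]

theorem minorDet_of_fixed {J : Finset α} {f : α → α} (h : ∀ i ∈ J, f i = i) :
    minorDet J f = 1 := by
  unfold minorDet
  rw [← Matrix.det_one (n := α) (R := ℤ)]
  congr 1
  ext i j
  by_cases hi : i ∈ J <;> simp [hi, h, Matrix.one_apply]

theorem minorDet_singleton (y : α) (f : α → α) :
    minorDet {y} f = if f y = y then 1 else 0 := by
  split_ifs with h
  · exact minorDet_of_fixed (by simpa using h)
  · exact minorDet_eq_zero (mem_singleton_self y) (by simpa using h)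

theorem minorDet_erase (x : α) (g : Perm α) :
    minorDet (univ.erase x) g = if g x = x then (Perm.sign g : ℤ) else 0 := by
  split_ifs with h
  · rw [← Int.cast_id (n := (Perm.sign g : ℤ)), ← Matrix.det_permutation g (R := ℤ)]
    unfold minorDet
    congr 1
    ext i j
    by_cases hi : i = x
    · subst hi
      simp [h, Equiv.Perm.permMatrix, PEquiv.toMatrix_apply, eq_comm]
    · rw [Matrix.of_apply, if_pos (mem_erase.2 ⟨hi, mem_univ i⟩)]
      simp [Equiv.Perm.permMatrix, PEquiv.toMatrix_apply, eq_comm]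
  · have hx : g⁻¹ x ≠ x := fun e => h (by rw [← Perm.eq_inv_iff_eq, e])
    exact minorDet_eq_zero (i := g⁻¹ x) (by simpa using hx) (by simp)

theorem minorDet_swap_comp {J : Finset α} {f : α → α} {p q : α} (hp : p ∈ J) (hq : q ∈ J)
    (hpq : p ≠ q) : minorDet J (fun i => swap p q (f i)) = -minorDet J f := by
  have := Matrix.det_permute' (swap p q)
    (Matrix.of fun i j => if (if i ∈ J then f i else i) = j then (1 : ℤ) else 0)
  rw [Perm.sign_swap hpq] at this
  simp only [Units.val_neg, Units.val_one, Int.cast_neg, Int.cast_one, neg_one_mul] at this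
  unfold minorDet
  rw [← this]
  congr 1
  ext i j
  by_cases hi : i ∈ J
  · simp [hi, swap_apply_eq_iff]
  · have : swap p q i = i := swap_apply_of_ne_of_ne (fun e => hi (e ▸ hp)) (fun e => hi (e ▸ hq))
    have h2 : i = swap p q j ↔ i = j := by rw [eq_comm, swap_apply_eq_iff, this, eq_comm]
    simp [hi, h2]

theorem minorDet_comp_swap {J : Finset α} {f : α → α} {p q : α} (hp : p ∈ J) (hq : q ∈ J)
    (hpq : p ≠ q) : minorDet J (fun i => f (swap p q i)) = -minorDet J f := by
  have := Matrix.det_permute (swap p q)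
    (Matrix.of fun i j => if (if i ∈ J then f i else i) = j then (1 : ℤ) else 0)
  rw [Perm.sign_swap hpq] at this
  simp only [Units.val_neg, Units.val_one, Int.cast_neg, Int.cast_one, neg_one_mul] at this
  unfold minorDet
  rw [← this]
  congr 1
  ext i j
  by_cases hi : i ∈ J
  · have : swap p q i ∈ J := by
      rw [swap_apply_def]
      split_ifs <;> assumption
    simp [hi, this]
  · have : swap p q i = i := swap_apply_of_ne_of_ne (fun e => hi (e ▸ hp)) (fun e => hi (e ▸ hq))
    simp [hi, this]

/-- Each row on the right is a sum of two vectors; expand multilinearly, `J` recording the rows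
where the first is chosen. That vector is zero in row `x`, which removes every `J` containing `x`.
-/
theorem sum_minorDet_eq_det (x : α) (f : α → α) :
    ∑ J ∈ (univ.erase x).powerset, (-1) ^ #J * minorDet J f =
      Matrix.det (Matrix.of fun i j => (if i = x then 0 else -(if f i = j then (1 : ℤ) else 0)) +
        if i = j then (1 : ℤ) else 0) := by
  have h := MultilinearMap.map_add_univ
    (Matrix.detRowAlternating (n := α) (R := ℤ)).toMultilinearMap
    (fun i j => (if i = x then 0 else -(if f i = j then (1 : ℤ) else 0)))
    (fun i j => if i = j then (1 : ℤ) else 0)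
  refine Eq.trans ?_ h.symm
  have hsub : (univ.erase x).powerset ⊆ (univ : Finset (Finset α)) := subset_univ _
  rw [← sum_subset hsub]
  · refine sum_congr rfl fun J hJ => ?_
    have hx : x ∉ J := fun hxJ => by simpa using mem_powerset.1 hJ hxJ
    have h2 := MultilinearMap.map_piecewise_smul
      (Matrix.detRowAlternating (n := α) (R := ℤ)).toMultilinearMap (fun _ => (-1 : ℤ))
      (fun i j => if (if i ∈ J then f i else i) = j then (1 : ℤ) else 0) J
    rw [prod_const, smul_eq_mul] at h2
    refine h2.symm.trans ?_
    congr 1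
    ext i j
    by_cases hi : i ∈ J
    · have : i ≠ x := fun e => hx (e ▸ hi)
      simp [hi, this]
    · simp [hi]
  · intro J _ hJ
    have hx : x ∈ J := by
      by_contra hx
      exact hJ (mem_powerset.2 fun i hi => by simpa using fun e : i = x => hx (e ▸ hi))
    refine MultilinearMap.map_coord_zero _ x ?_
    ext j
    simp [hx]

open Classical in
/-- The indicator of full cycles as a signed sum of minors. -/
theorem sum_minorDet_perm (x : α) (g : Perm α) :
    ∑ J ∈ (univ.erase x).powerset, (-1) ^ #J * minorDet J g =
      if IsFullCycle g then 1 else 0 := by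
  split_ifs with h
  · rw [sum_eq_single ∅]
    · simp [minorDet_of_fixed]
    · intro J hJ hne
      have hx : x ∉ J := fun hxJ => by simpa using mem_powerset.1 hJ hxJ
      have : ∃ y ∈ J, g y ∉ J := by
        by_contra! hc
        exact hx (h J (nonempty_iff_ne_empty.2 hne) hc ▸ mem_univ x)
      obtain ⟨y, hy, hgy⟩ := this
      rw [minorDet_eq_zero hy hgy, mul_zero]
    · simp
  · rw [sum_minorDet_eq_det, ← Matrix.exists_mulVec_eq_zero_iff]
    have : ∃ y, ¬ g.SameCycle x y := by
      by_contra! hc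
      exact h ((isFullCycle_iff_sameCycle g).2 fun a b => (hc a).symm.trans (hc b))
    obtain ⟨y, hy⟩ := this
    -- The indicator of an orbit missing `x` is a nonzero null vector.
    obtain ⟨v, hvx, hvy, hvg⟩ : ∃ v : α → ℤ, v x = 0 ∧ v y = 1 ∧ ∀ i, v (g i) = v i := by
      refine ⟨fun z => if g.SameCycle y z then 1 else 0, if_neg fun e => hy e.symm,
        if_pos (Perm.SameCycle.refl _ _), fun i => ?_⟩
      simp
    refine ⟨v, fun e => by simp [e] at hvy, ?_⟩
    ext i
    by_cases hi : i = x
    · subst hi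
      simp [Matrix.mulVec, dotProduct, hvx]
    · simp [Matrix.mulVec, dotProduct, hi, add_mul, sum_add_distrib, hvg]

end

/-! ### Cancellation of the intermediate minors -/

section
variable {α : Type*} [Fintype α] [DecidableEq α]

/-- Exchanging the fixed point `c ∈ J` of a near-cycle against a new fixed point outside `J`,
where `s` maps `J` onto `K = (J \ {a}) ∪ {b}`. -/
theorem IsNearCycle.exchange {s : Perm α} {c a b : α} {J K : Finset α} (h : IsNearCycle s c)
    (hcJ : c ∈ J) (hsJ : ∀ y, s y ∈ K ↔ y ∈ J) (haJ : a ∈ J) (haK : a ∉ K) (hbJ : b ∉ J)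
    (hbK : b ∈ K) (hJK : ∀ y, y ≠ a → y ≠ b → (y ∈ J ↔ y ∈ K)) (hz : ∃ z, z ∉ J ∧ z ≠ b) :
    let q := s⁻¹ a
    let s' := swap q a * swap c b * s
    IsNearCycle s' q ∧ q ∉ J ∧ q ∉ K ∧ c ∈ K ∧ (∀ y, s' y ∈ K ↔ y ∈ J) ∧ s'⁻¹ b = c ∧
      swap c b * swap q a * s' = s := by
  intro q s'
  have hcK : c ∈ K := by have := (hsJ c).2 hcJ; rwa [h.1] at this
  have hsq : s q = a := by simp [q]
  have hqJ : q ∉ J := fun e => haK (hsq ▸ (hsJ q).2 e)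
  have hca : c ≠ a := fun e => haK (e ▸ hcK)
  have hcb : c ≠ b := fun e => hbJ (e ▸ hcJ)
  have hab : a ≠ b := fun e => hbJ (e ▸ haJ)
  -- If `s b = a`, then `J ∪ {b}` minus `c` is closed under `s`, hence is everything except `c`; the
  -- letter supplied by `hz` contradicts this.
  have hqb : q ≠ b := by
    intro e
    have := h.2 ((insert b J).erase c) (by simp) ⟨b, by simp [hcb.symm]⟩ (by
      intro y hy
      obtain ⟨hyc, hy⟩ := mem_erase.1 hy
      refine mem_erase.2 ⟨fun e => hyc (s.injective (e.trans h.1.symm)), ?_⟩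
      rcases mem_insert.1 hy with rfl | hy
      · rw [← e, hsq]
        exact mem_insert_of_mem haJ
      · by_cases hb : s y = b
        · simp [hb]
        · have h1 := (hsJ y).2 hy
          exact mem_insert_of_mem ((hJK _ (fun e => haK (e ▸ h1)) hb).2 h1))
    obtain ⟨z, hzJ, hzb⟩ := hz
    have hzc : z ≠ c := fun e => hzJ (e ▸ hcJ)
    have : z ∈ (insert b J).erase c := this ▸ mem_erase.2 ⟨hzc, mem_univ z⟩
    simp [hzb, hzJ] at this
  have hqa : q ≠ a := fun e => hqJ (e ▸ haJ)
  have hqc : q ≠ c := fun e => hqJ (e ▸ hcJ)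
  have hqK : q ∉ K := fun e => hqJ ((hJK q hqa hqb).2 e)
  have hTq : (swap c b * s) q = a := by
    simp [hsq, swap_apply_of_ne_of_ne hca.symm hab]
  -- Splice `c` into the cycle before `b`, then cut out `q`.
  have hN := (h.swap_mul hcb.symm).swap_mul q
  rw [hTq, ← mul_assoc] at hN
  refine ⟨hN, hqJ, hqK, hcK, ?_, ?_, ?_⟩
  · intro y
    rw [← hsJ]
    have hA : ∀ w, swap c b w ∈ K ↔ w ∈ K := by
      intro w
      rw [swap_apply_def]
      split_ifs with h1 h2 <;> simp_all
    have hB : ∀ w, swap q a w ∈ K ↔ w ∈ K := by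
      intro w
      rw [swap_apply_def]
      split_ifs with h1 h2 <;> simp_all
    exact (hB _).trans (hA _)
  · rw [Perm.inv_eq_iff_eq]
    simp [s', h.1, swap_apply_of_ne_of_ne hqb.symm hab.symm]
  · have hcomm : swap q a * swap c b = swap c b * swap q a := by
      refine Perm.Disjoint.commute ?_
      intro w
      by_cases h1 : w = q ∨ w = a
      · right
        rcases h1 with rfl | rfl
        · exact swap_apply_of_ne_of_ne hqc hqb
        · exact swap_apply_of_ne_of_ne hca.symm hab
      · push Not at h1
        exact Or.inl (swap_apply_of_ne_of_ne h1.1 h1.2)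
    change swap c b * swap q a * (swap q a * swap c b * s) = s
    rw [← mul_assoc, mul_assoc (swap c b), ← mul_assoc (swap q a), swap_mul_self, one_mul,
      swap_mul_self, one_mul]

/-- A nonzero minor forces `s⁻¹ * u` to preserve `J`, so `s` carries `J` onto its image under `u`.
-/
theorem minorDet_ne_zero_closed {J : Finset α} {s u : Perm α}
    (h : minorDet J (⇑(s⁻¹ * u)) ≠ 0) : ∀ y, s y ∈ J.map u.toEmbedding ↔ y ∈ J := by
  have h1 : ∀ y ∈ J, s⁻¹ (u y) ∈ J := by
    intro y hy
    by_contra hc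
    exact h (minorDet_eq_zero hy (by simpa using hc))
  have h2 : (J.map u.toEmbedding).map (s⁻¹ : Perm α).toEmbedding = J := by
    refine eq_of_subset_of_card_le ?_ (by simp)
    intro y hy
    simp only [mem_map_equiv] at hy
    simpa using h1 _ hy
  intro y
  conv_rhs => rw [← h2]
  rw [mem_map_equiv (f := (s⁻¹ : Perm α))]
  rfl

open Classical in
-- Let `K` be the image of `J` under `u`; only `s` carrying `J` onto `K` contribute. If `J = K`,
-- there are none, since `J` without the fixed point would be closed and too small. If `J \ K` is a
-- single letter, exchanging a fixed point in `J` with one outside reverses the sign. If `J \ K` has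
-- two letters, conjugation by their swap does.
theorem sum_minorDet_eq_zero (u : Perm α) (J : Finset α) (h2 : 2 ≤ #J)
    (hN : #J + 2 ≤ Fintype.card α) :
    ∑ p : α × Perm α with IsNearCycle p.2 p.1, minorDet J (⇑(p.2⁻¹ * u)) = 0 := by
  set K := J.map u.toEmbedding with hK
  have hcard : #K = #J := by simp [K]
  have huK : ∀ i ∈ J, u i ∈ K := fun i hi => by simpa [K] using hi
  rcases lt_trichotomy #(J \ K) 1 with h0 | h1 | hge
  · have hJK : J ⊆ K := by
      rw [← sdiff_eq_empty_iff_subset, ← card_eq_zero]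
      omega
    have hJK : J = K := eq_of_subset_of_card_le hJK hcard.le
    refine sum_eq_zero fun p hp => ?_
    by_contra hne
    have hcl := minorDet_ne_zero_closed hne
    rw [← hK, ← hJK] at hcl
    have hp : IsNearCycle p.2 p.1 := by simpa using hp
    have := hp.2 (J.erase p.1) (by simp) (by
        rw [← card_pos]
        have := pred_card_le_card_erase (s := J) (a := p.1)
        omega) (by
      intro y hy
      obtain ⟨hy1, hy2⟩ := mem_erase.1 hy
      exact mem_erase.2 ⟨fun e => hy1 (p.2.injective (e.trans hp.1.symm)), (hcl y).2 hy2⟩)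
    have hc := congrArg card this
    rw [card_erase_of_mem (mem_univ _), card_univ] at hc
    have := card_erase_le (s := J) (a := p.1)
    omega
  · obtain ⟨a, ha⟩ := card_eq_one.1 h1
    obtain ⟨b, hb⟩ := card_eq_one.1 ((card_sdiff_comm hcard).trans h1)
    have haJK : a ∈ J ∧ a ∉ K := mem_sdiff.1 (ha ▸ mem_singleton_self a)
    have hbJK : b ∈ K ∧ b ∉ J := mem_sdiff.1 (hb ▸ mem_singleton_self b)
    have hJK : ∀ y, y ≠ a → y ≠ b → (y ∈ J ↔ y ∈ K) := by
      intro y hya hyb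
      constructor
      · intro hy
        by_contra hc
        exact hya (mem_singleton.1 (ha ▸ mem_sdiff.2 ⟨hy, hc⟩))
      · intro hy
        by_contra hc
        exact hyb (mem_singleton.1 (hb ▸ mem_sdiff.2 ⟨hy, hc⟩))
    have hz1 : ∃ z, z ∉ J ∧ z ≠ b := by
      by_contra! hc
      have : (univ : Finset α) ⊆ insert b J := fun z _ => by
        by_cases hz : z ∈ J
        · exact mem_insert_of_mem hz
        · simp [hc z hz]
      have := (card_le_card this).trans (card_insert_le b J)
      rw [card_univ] at this
      omega
    have hz2 : ∃ z, z ∉ Jᶜ ∧ z ≠ a := by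
      obtain ⟨z, hz, hza⟩ := exists_mem_ne (by omega : 1 < #J) a
      exact ⟨z, by simpa using hz, hza⟩
    set S := univ.filter fun p : α × Perm α => IsNearCycle p.2 p.1 ∧ ∀ y, p.2 y ∈ K ↔ y ∈ J
      with hS
    have hred : ∑ p : α × Perm α with IsNearCycle p.2 p.1, minorDet J (⇑(p.2⁻¹ * u)) =
        ∑ p ∈ S, minorDet J (⇑(p.2⁻¹ * u)) := by
      symm
      refine sum_subset (fun p hp => ?_) fun p hp hpS => ?_
      · simp only [S, mem_filter, mem_univ, true_and] at hp ⊢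
        exact hp.1
      · by_contra hne
        simp only [S, mem_filter, mem_univ, true_and] at hp hpS
        exact hpS ⟨hp, minorDet_ne_zero_closed hne⟩
    rw [hred, ← sum_filter_add_sum_filter_not S (fun p => p.1 ∈ J), ← eq_neg_iff_add_eq_zero,
      ← sum_neg_distrib]
    have fwd : ∀ p ∈ S.filter (fun p => p.1 ∈ J), _ := fun p hp => by
      simp only [S, mem_filter, mem_univ, true_and] at hp
      exact hp.1.1.exchange hp.2 hp.1.2 haJK.1 haJK.2 hbJK.2 hbJK.1 hJK hz1
    -- Passing to complements exchanges the roles of `a` and `b`, so the same move gives the inverse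
    -- map.
    have bwd : ∀ p ∈ S.filter (fun p => ¬ p.1 ∈ J), _ := fun p hp => by
      simp only [S, mem_filter, mem_univ, true_and] at hp
      exact hp.1.1.exchange (J := Jᶜ) (K := Kᶜ) (a := b) (b := a) (by simpa using hp.2)
        (by simpa using fun y => not_congr (hp.1.2 y)) (by simpa using hbJK.2)
        (by simpa using hbJK.1) (by simpa using haJK.1) (by simpa using haJK.2)
        (fun y h h' => by simpa using not_congr (hJK y h' h)) hz2
    refine sum_nbij' (fun p => (p.2⁻¹ a, swap (p.2⁻¹ a) a * swap p.1 b * p.2))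
      (fun p => (p.2⁻¹ b, swap (p.2⁻¹ b) b * swap p.1 a * p.2)) ?_ ?_ ?_ ?_ ?_
    · intro p hp
      obtain ⟨e1, e2, e3, e4, e5, e6, e7⟩ := fwd p hp
      simp only [S, mem_filter, mem_univ, true_and]
      exact ⟨⟨e1, e5⟩, e2⟩
    · intro p hp
      obtain ⟨e1, e2, e3, e4, e5, e6, e7⟩ := bwd p hp
      simp only [S, mem_filter, mem_univ, true_and]
      refine ⟨⟨e1, fun y => ?_⟩, by simpa using e2⟩
      have := e5 y
      simp only [mem_compl] at this
      exact not_iff_not.1 this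
    · intro p hp
      obtain ⟨e1, e2, e3, e4, e5, e6, e7⟩ := fwd p hp
      exact Prod.ext e6 (by dsimp only; rw [e6]; exact e7)
    · intro p hp
      obtain ⟨e1, e2, e3, e4, e5, e6, e7⟩ := bwd p hp
      exact Prod.ext e6 (by dsimp only; rw [e6]; exact e7)
    · intro p hp
      obtain ⟨e1, e2, e3, e4, e5, e6, e7⟩ := fwd p hp
      have hcJ : p.1 ∈ J := (mem_filter.1 hp).2
      have hc1 : u⁻¹ p.1 ∈ J := by simpa [K, mem_map_equiv] using e4
      have hb1 : u⁻¹ b ∈ J := by simpa [K, mem_map_equiv] using hbJK.1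
      have hne : u⁻¹ p.1 ≠ u⁻¹ b := fun e =>
        hbJK.2 (by rw [← u⁻¹.injective e]; exact hcJ)
      -- On `J` the new permutation is the old one precomposed with the swap of `u⁻¹ c` and `u⁻¹ b`,
      -- where `c = p.1`: the other transposition moves only letters outside `K`.
      rw [← minorDet_comp_swap (f := ⇑((swap (p.2⁻¹ a) a * swap p.1 b * p.2)⁻¹ * u)) hc1 hb1 hne]
      refine minorDet_congr fun i hi => ?_
      have hui : (swap (p.2⁻¹ a) a) (u (swap (u⁻¹ p.1) (u⁻¹ b) i)) =
          u (swap (u⁻¹ p.1) (u⁻¹ b) i) := by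
        have : u (swap (u⁻¹ p.1) (u⁻¹ b) i) ∈ K := by
          refine huK _ ?_
          rw [swap_apply_def]
          split_ifs <;> assumption
        exact swap_apply_of_ne_of_ne (fun e => e3 (e ▸ this)) (fun e => haJK.2 (e ▸ this))
      have hsw : u (swap (u⁻¹ p.1) (u⁻¹ b) i) = swap p.1 b (u i) := by
        have := swap_apply_apply u (u⁻¹ p.1) (u⁻¹ b)
        have hinv : ∀ z, u (u⁻¹ z) = z := fun z => by simp
        rw [hinv, hinv] at this
        rw [this]
        simp
      simp only [mul_inv_rev, swap_inv, Perm.mul_apply]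
      rw [hui, hsw, swap_apply_self]
  -- The swap `τ` of `p` and `q` fixes `K` pointwise. Conjugating `s` by it thus only postcomposes
  -- `s⁻¹ * u` with `τ` on `J`, and the sum equals its own negative.
  · obtain ⟨p, hp, q, hq, hpq⟩ := one_lt_card.1 hge
    rw [mem_sdiff] at hp hq
    set τ := swap p q with hτ
    have hself : ∑ x : α × Perm α with IsNearCycle x.2 x.1, minorDet J (⇑(x.2⁻¹ * u)) =
        ∑ x : α × Perm α with IsNearCycle x.2 x.1, -minorDet J (⇑(x.2⁻¹ * u)) := by
      refine sum_nbij' (fun x => (τ x.1, τ * x.2 * τ⁻¹)) (fun x => (τ⁻¹ x.1, τ⁻¹ * x.2 * τ))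
        ?_ ?_ ?_ ?_ ?_
      · intro x hx
        simp only [mem_filter, mem_univ, true_and] at hx ⊢
        exact hx.conj τ
      · intro x hx
        simp only [mem_filter, mem_univ, true_and] at hx ⊢
        simpa using hx.conj τ⁻¹
      · intro x _
        simp [mul_assoc]
      · intro x _
        simp [mul_assoc]
      · intro x _
        rw [← minorDet_swap_comp hp.1 hq.1 hpq]
        refine minorDet_congr fun i hi => ?_
        have : swap p q (u i) = u i := swap_apply_of_ne_of_ne
          (fun e => hp.2 (e ▸ huK i hi)) (fun e => hq.2 (e ▸ huK i hi))
        simp [τ, mul_inv_rev, this]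
    rw [sum_neg_distrib] at hself
    omega

end

/-! ### Counting near-cycles and factorizations -/

section
variable {α : Type*} [Fintype α] [DecidableEq α]

open Classical in
theorem card_isNearCycle_eq (a b : α) :
    #{s : Perm α | IsNearCycle s a} = #{s : Perm α | IsNearCycle s b} := by
  refine card_nbij' (fun s => swap a b * s * (swap a b)⁻¹) (fun s => swap a b * s * (swap a b)⁻¹)
    ?_ ?_ ?_ ?_
  · intro s hs
    have := IsNearCycle.conj (by simpa using hs) (swap a b)
    simpa using this
  · intro s hs
    have := IsNearCycle.conj (by simpa using hs) (swap a b)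
    simpa using this
  · intro s _
    simp [mul_assoc]
  · intro s _
    simp [mul_assoc]

open Classical in
theorem card_isNearCycle_pairs (a : α) :
    #{p : α × Perm α | IsNearCycle p.2 p.1} =
      Fintype.card α * #{s : Perm α | IsNearCycle s a} := by
  rw [card_filter, ← univ_product_univ, sum_product]
  simp only [← card_filter]
  rw [sum_congr rfl fun b _ => card_isNearCycle_eq b a, sum_const, card_univ, smul_eq_mul]

open Classical in
-- For `y = x` the fixed point must be `x`. By conjugation the other values of `y` are equally
-- frequent, and they share what remains of the total `N * M`.
theorem card_isNearCycle_pairs_apply (h3 : 3 ≤ Fintype.card α) (a x y : α) :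
    #{p : α × Perm α | IsNearCycle p.2 p.1 ∧ p.2 x = y} = #{s : Perm α | IsNearCycle s a} := by
  have hfix : #{p : α × Perm α | IsNearCycle p.2 p.1 ∧ p.2 x = x} =
      #{s : Perm α | IsNearCycle s a} := by
    -- With only two letters the identity is a near-cycle fixing both, hence the bound `h3`.
    have huniq : ∀ p : α × Perm α, IsNearCycle p.2 p.1 → p.2 x = x → p.1 = x := by
      intro p hp hx
      by_contra hne
      have := congrArg card (hp.2 {x} (by simpa using hne) (by simp) (by simpa using hx))
      rw [card_singleton, card_erase_of_mem (mem_univ _), card_univ] at this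
      omega
    rw [card_isNearCycle_eq a x]
    refine card_nbij' (fun p => p.2) (fun s => (x, s)) ?_ ?_ ?_ ?_
    · intro p hp
      simp only [coe_filter, mem_univ, true_and, Set.mem_ofPred_eq] at hp ⊢
      exact huniq p hp.1 hp.2 ▸ hp.1
    · intro s hs
      simp only [coe_filter, mem_univ, true_and, Set.mem_ofPred_eq] at hs ⊢
      exact ⟨hs, hs.1⟩
    · intro p hp
      simp only [coe_filter, mem_univ, true_and, Set.mem_ofPred_eq] at hp
      exact Prod.ext (huniq p hp.1 hp.2).symm rfl
    · intro s _
      rfl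
  by_cases hxy : x = y
  · subst hxy
    exact hfix
  have hconst : ∀ z ∈ univ.erase x, #{p : α × Perm α | IsNearCycle p.2 p.1 ∧ p.2 x = z} =
      #{p : α × Perm α | IsNearCycle p.2 p.1 ∧ p.2 x = y} := by
    intro z hz
    have hzx : x ≠ z := (ne_of_mem_erase hz).symm
    have hx : swap y z x = x := swap_apply_of_ne_of_ne hxy hzx
    refine card_nbij' (fun p => (swap y z p.1, swap y z * p.2 * (swap y z)⁻¹))
      (fun p => (swap y z p.1, swap y z * p.2 * (swap y z)⁻¹)) ?_ ?_ ?_ ?_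
    · intro p hp
      simp only [coe_filter, mem_univ, true_and, Set.mem_ofPred_eq] at hp ⊢
      exact ⟨hp.1.conj _, by simp [hx, hp.2]⟩
    · intro p hp
      simp only [coe_filter, mem_univ, true_and, Set.mem_ofPred_eq] at hp ⊢
      exact ⟨hp.1.conj _, by simp [hx, hp.2]⟩
    · intro p _
      simp [mul_assoc]
    · intro p _
      simp [mul_assoc]
  have htot : ∑ z, #{p : α × Perm α | IsNearCycle p.2 p.1 ∧ p.2 x = z} =
      Fintype.card α * #{s : Perm α | IsNearCycle s a} := by
    rw [← card_isNearCycle_pairs a, card_eq_sum_card_fiberwise (f := fun p => p.2 x) (t := univ)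
      (fun _ _ => by simp)]
    simp only [filter_filter]
  rw [← add_sum_erase _ _ (mem_univ x), hfix, sum_congr rfl hconst, sum_const,
    card_erase_of_mem (mem_univ x), card_univ, smul_eq_mul] at htot
  obtain ⟨k, hk⟩ : ∃ k, Fintype.card α = k + 1 := ⟨_, (Nat.succ_pred_eq_of_pos (by omega)).symm⟩
  rw [hk, Nat.add_sub_cancel, add_mul, one_mul, add_comm] at htot
  exact Nat.eq_of_mul_eq_mul_left (by omega) (Nat.add_right_cancel htot)

open Classical in
theorem card_near_mul_full (h3 : 3 ≤ Fintype.card α) (a : α) (u : Perm α) :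
    (#{p : α × Perm α | IsNearCycle p.2 p.1 ∧ IsFullCycle (p.2⁻¹ * u)} : ℤ) =
      #{s : Perm α | IsNearCycle s a} * (1 - Perm.sign u) := by
  have : Nontrivial α := Fintype.one_lt_card_iff_nontrivial.1 (by omega)
  obtain ⟨m, hm⟩ : ∃ m, Fintype.card α = m + 3 := ⟨_, (Nat.sub_add_cancel h3).symm⟩
  set M := #{s : Perm α | IsNearCycle s a} with hM
  set P := univ.filter fun p : α × Perm α => IsNearCycle p.2 p.1 with hP
  have hcard : #((univ : Finset α).erase a) = m + 2 := by
    rw [card_erase_of_mem (mem_univ a), card_univ, hm]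
    rfl
  have happ : ∀ x, #{p ∈ P | p.2 x = u x} = M := fun x => by
    rw [filter_filter]
    exact card_isNearCycle_pairs_apply h3 a x (u x)
  have hinv : ∀ (s : Perm α) x, (s⁻¹ * u) x = x ↔ s x = u x := fun s x => by
    rw [Perm.mul_apply, Perm.inv_eq_iff_eq, eq_comm]
  rw [← filter_filter, card_filter]
  push_cast
  rw [sum_congr rfl fun p _ => (sum_minorDet_perm a (p.2⁻¹ * u)).symm, sum_comm]
  simp only [← mul_sum]
  rw [sum_powerset, hcard, sum_range_succ, sum_range_succ', sum_range_succ']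
  have hmid : ∑ k ∈ range m, ∑ J ∈ powersetCard (k + 1 + 1) ((univ : Finset α).erase a),
      (-1 : ℤ) ^ #J * ∑ p ∈ P, minorDet J (⇑(p.2⁻¹ * u)) = 0 := by
    refine sum_eq_zero fun k hk => sum_eq_zero fun J hJ => ?_
    have hJ := (mem_powersetCard.1 hJ).2
    have hk := mem_range.1 hk
    rw [hP, sum_minorDet_eq_zero u J (by omega) (by omega), mul_zero]
  have h1 : ∑ J ∈ powersetCard (0 + 1) ((univ : Finset α).erase a),
      (-1 : ℤ) ^ #J * ∑ p ∈ P, minorDet J (⇑(p.2⁻¹ * u)) = -((m + 2) * M) := by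
    rw [zero_add, powersetCard_one, sum_map]
    rw [sum_congr rfl (g := fun _ => -(M : ℤ))]
    · rw [sum_const, hcard]
      simp
    · intro y _
      simp only [Function.Embedding.coeFn_mk, card_singleton, pow_one, minorDet_singleton, hinv]
      rw [← happ y, card_filter]
      push_cast
      ring
  -- The empty minor is 1 for each of the `N * M` pairs.
  have h0 : ∑ J ∈ powersetCard 0 ((univ : Finset α).erase a),
      (-1 : ℤ) ^ #J * ∑ p ∈ P, minorDet J (⇑(p.2⁻¹ * u)) = (m + 3) * M := by
    rw [powersetCard_zero, sum_singleton]
    simp only [card_empty, pow_zero, one_mul]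
    rw [sum_congr rfl fun p _ => minorDet_of_fixed (by simp), sum_const, hP,
      card_isNearCycle_pairs a, hm]
    simp [hM]
  -- The top minor is nonzero exactly when `s a = u a`, and then equals the sign of `s⁻¹ * u`.
  have hlast : ∑ J ∈ powersetCard (m + 2) ((univ : Finset α).erase a),
      (-1 : ℤ) ^ #J * ∑ p ∈ P, minorDet J (⇑(p.2⁻¹ * u)) = - (M * Perm.sign u) := by
    rw [← hcard, powersetCard_self, sum_singleton, hcard]
    simp only [minorDet_erase, hinv]
    rw [← sum_filter, sum_congr rfl (g := fun _ => (-1 : ℤ) ^ (m + 3) * Perm.sign u)]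
    · rw [sum_const, happ a, nsmul_eq_mul]
      have : (-1 : ℤ) ^ (m + 2) * (-1) ^ (m + 3) = -1 := by
        rw [← pow_add]
        exact Odd.neg_one_pow ⟨m + 2, by ring⟩
      linear_combination (M * Perm.sign u : ℤ) * this
    · intro p hp
      have hp : IsNearCycle p.2 p.1 := by simpa [P] using (mem_filter.1 hp).1
      rw [Perm.sign_mul, Perm.sign_inv, hp.sign, hm]
      simp
  rw [hmid, h1, h0, hlast]
  ring

end

/-! ### Orbit sizes and multiplicities of parts -/

/-- The size of the orbit of `z` under `g`. -/
def orbitCard {α : Type*} [Fintype α] [DecidableEq α] (g : Perm α) (z : α) : ℕ :=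
  #{w | g.SameCycle z w}

section
variable {α : Type*} [Fintype α] [DecidableEq α]

theorem orbitCard_pos (g : Perm α) (z : α) : 0 < orbitCard g z :=
  card_pos.2 ⟨z, by simp [Perm.SameCycle.refl]⟩

theorem orbitCard_eq_of_sameCycle {g : Perm α} {z w : α} (h : g.SameCycle z w) :
    orbitCard g z = orbitCard g w := by
  unfold orbitCard
  congr 1
  ext v
  simpa using ⟨h.symm.trans, h.trans⟩

theorem orbitCard_of_fixed {g : Perm α} {z : α} (h : g z = z) : orbitCard g z = 1 := by
  rw [orbitCard, card_eq_one]
  refine ⟨z, ?_⟩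
  ext w
  simp only [mem_filter, mem_univ, true_and, mem_singleton]
  constructor
  · rintro ⟨i, rfl⟩
    exact Perm.zpow_apply_eq_self_of_apply_eq_self h i
  · rintro rfl
    exact Perm.SameCycle.refl _ _

theorem orbitCard_of_not_fixed {g : Perm α} {z : α} (h : g z ≠ z) :
    orbitCard g z = #(g.cycleOf z).support := by
  unfold orbitCard
  congr 1
  ext w
  rw [Perm.mem_support_cycleOf_iff, Perm.mem_support]
  simp [h]

/-- Each cycle of length `i` contributes `i` letters. Length 1 is treated apart because `cycleType`
omits fixed points. -/
theorem mul_count_partition (g : Perm α) (i : ℕ) :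
    i * g.partition.parts.count i = #{z | orbitCard g z = i} := by
  have hlarge : ∀ z, g z ≠ z → 2 ≤ orbitCard g z := by
    intro z hz
    rw [orbitCard_of_not_fixed hz]
    exact (Perm.isCycle_cycleOf g hz).two_le_card_support
  rw [Perm.parts_partition, Multiset.count_add, Multiset.count_replicate]
  rcases (by omega : i = 0 ∨ i = 1 ∨ 2 ≤ i) with rfl | rfl | hi
  · rw [zero_mul, eq_comm, card_eq_zero, filter_eq_empty_iff]
    exact fun z _ => (orbitCard_pos g z).ne'
  · have h1 : g.cycleType.count 1 = 0 := Multiset.count_eq_zero.2 fun h =>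
      absurd (Perm.two_le_of_mem_cycleType h) (by norm_num)
    rw [h1, if_pos rfl, zero_add, one_mul, ← card_compl]
    congr 1
    ext z
    simp only [mem_compl, Perm.mem_support, not_not, mem_filter, mem_univ, true_and]
    refine ⟨orbitCard_of_fixed, fun h => ?_⟩
    by_contra hz
    have := hlarge z hz
    omega
  · rw [if_neg (by omega), add_zero, Perm.cycleType_def, Multiset.count_map]
    set C := g.cycleFactorsFinset.filter fun c => i = #c.support with hC
    have hmaps : ∀ z ∈ univ.filter (fun z => orbitCard g z = i), g.cycleOf z ∈ C := by
      intro z hz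
      have hz : orbitCard g z = i := by simpa using hz
      have hgz : g z ≠ z := fun e => by rw [orbitCard_of_fixed e] at hz; omega
      rw [hC, mem_filter, Perm.cycleOf_mem_cycleFactorsFinset_iff, Perm.mem_support]
      exact ⟨hgz, by rw [← orbitCard_of_not_fixed hgz, hz]⟩
    rw [card_eq_sum_card_fiberwise hmaps]
    rw [sum_congr rfl (g := fun _ => i)]
    · rw [sum_const, smul_eq_mul, mul_comm]
      rfl
    · intro c hc
      obtain ⟨hc, hci⟩ := mem_filter.1 hc
      conv_rhs => rw [hci]
      congr 1
      ext z
      simp only [mem_filter, mem_univ, true_and]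
      constructor
      · rintro ⟨hz, rfl⟩
        have hgz : g z ≠ z := fun e => by rw [orbitCard_of_fixed e] at hz; omega
        simpa [Perm.mem_support_cycleOf_iff, Perm.SameCycle.refl] using hgz
      · intro hz
        have hcz := Perm.cycle_is_cycleOf hz hc
        have hgz : g z ≠ z := by
          rw [← Perm.mem_support]
          exact Perm.mem_cycleFactorsFinset_support_le hc hz
        exact ⟨by rw [orbitCard_of_not_fixed hgz, ← hcz, hci], hcz.symm⟩

theorem orbitCard_mem_partition (g : Perm α) (z : α) : orbitCard g z ∈ g.partition.parts := by
  rw [← Multiset.count_pos]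
  refine Nat.pos_of_mul_pos_left (a := orbitCard g z) ?_
  rw [mul_count_partition]
  exact card_pos.2 ⟨z, by simp⟩

end

/-! ### Inserting a letter into a cycle -/

theorem sameCycle_of_step {α β : Type*} [Finite α] {G : Perm α} {r : β → β → Prop} (hr : Equivalence r)
    (π : α → β) (h : ∀ a, r (π a) (π (G a))) {a b : α} (hab : G.SameCycle a b) :
    r (π a) (π b) := by
  obtain ⟨i, -, rfl⟩ := hab.exists_pow_eq'
  clear hab
  induction i with
  | zero => exact hr.refl _
  | succ k ih =>
    rw [pow_succ']
    exact hr.trans ih (h _)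

/-- The permutation of `Fin (n + 1)` obtained from `g` by inserting `0` before `y` in its cycle. -/
def insertZero {n : ℕ} (g : Perm (Fin n)) (y : Fin n) : Perm (Fin (n + 1)) :=
  Perm.decomposeFin.symm (y.succ, g)

section
variable {n : ℕ}

theorem insertZero_zero (g : Perm (Fin n)) (y : Fin n) : insertZero g y 0 = y.succ := by
  simp [insertZero]

theorem insertZero_succ (g : Perm (Fin n)) (y z : Fin n) :
    insertZero g y z.succ = if g z = y then 0 else (g z).succ := by
  rw [insertZero, Perm.decomposeFin_symm_apply_succ]
  split_ifs with h
  · rw [h, swap_apply_right]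
  · exact swap_apply_of_ne_of_ne (Fin.succ_ne_zero _) fun e => h (Fin.succ_injective _ e)

/-- Collapsing 0 onto `y` by `Fin.cases y id` turns each step of the enlarged permutation into a
step of `g` or into rest, so orbits correspond. -/
theorem sameCycle_insertZero (g : Perm (Fin n)) (y : Fin n) (a b : Fin (n + 1)) :
    (insertZero g y).SameCycle a b ↔
      g.SameCycle (Fin.cases y id a : Fin n) (Fin.cases y id b : Fin n) := by
  have hg : Equivalence g.SameCycle :=
    ⟨Perm.SameCycle.refl g, Perm.SameCycle.symm, Perm.SameCycle.trans⟩
  have hG : Equivalence (insertZero g y).SameCycle :=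
    ⟨Perm.SameCycle.refl _, Perm.SameCycle.symm, Perm.SameCycle.trans⟩
  have hstep : ∀ c : Fin (n + 1), (insertZero g y).SameCycle c (insertZero g y c) := fun c => by
    simp [Perm.SameCycle.refl]
  constructor
  · refine sameCycle_of_step hg (fun c : Fin (n + 1) => (Fin.cases y id c : Fin n)) fun c => ?_
    induction c using Fin.cases with
    | zero => simp [insertZero_zero, Perm.SameCycle.refl]
    | succ z =>
      rw [insertZero_succ]
      have hz : g.SameCycle z (g z) := by simp [Perm.SameCycle.refl]
      split_ifs with h
      · rw [h] at hz
        exact hz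
      · exact hz
  · intro h
    have hsucc : (insertZero g y).SameCycle (Fin.succ (Fin.cases y id a : Fin n))
        (Fin.succ (Fin.cases y id b : Fin n)) := by
      refine sameCycle_of_step hG Fin.succ (fun z => ?_) h
      have h1 := hstep z.succ
      rw [insertZero_succ] at h1
      split_ifs at h1 with hz
      · have h2 := h1.trans (hstep 0)
        rwa [insertZero_zero, ← congrArg Fin.succ hz] at h2
      · exact h1
    have hproj : ∀ c : Fin (n + 1),
        (insertZero g y).SameCycle c (Fin.succ (Fin.cases y id c : Fin n)) := by
      intro c
      induction c using Fin.cases with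
      | zero => have := hstep 0; rwa [insertZero_zero] at this
      | succ z => exact Perm.SameCycle.refl _ _
    exact (hproj a).trans (hsucc.trans (hproj b).symm)

theorem orbitCard_insertZero (g : Perm (Fin n)) (y : Fin n) (a : Fin (n + 1)) :
    orbitCard (insertZero g y) a = orbitCard g (Fin.cases y id a : Fin n) +
      if g.SameCycle (Fin.cases y id a : Fin n) y then 1 else 0 := by
  unfold orbitCard
  simp only [sameCycle_insertZero]
  rw [card_filter, Fin.sum_univ_succ, card_filter, add_comm]
  rfl

theorem orbitCard_insertZero_zero (g : Perm (Fin n)) (y : Fin n) :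
    orbitCard (insertZero g y) 0 = orbitCard g y + 1 :=
  (orbitCard_insertZero g y 0).trans (congrArg _ (if_pos (Perm.SameCycle.refl g y)))

theorem orbitCard_insertZero_succ (g : Perm (Fin n)) (y z : Fin n) :
    orbitCard (insertZero g y) z.succ = orbitCard g z + if g.SameCycle z y then 1 else 0 :=
  orbitCard_insertZero g y z.succ

theorem parts_insertZero (g : Perm (Fin n)) (y : Fin n) :
    (cyclePartition (insertZero g y)).parts =
      (orbitCard g y + 1) ::ₘ (cyclePartition g).parts.erase (orbitCard g y) := by
  set l := orbitCard g y with hl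
  have hmem : l ∈ (cyclePartition g).parts := orbitCard_mem_partition g y
  ext j
  have hnew : j * (cyclePartition (insertZero g y)).parts.count j =
      #{z | orbitCard (insertZero g y) z = j} := mul_count_partition _ j
  have hold : j * (cyclePartition g).parts.count j = #{z | orbitCard g z = j} :=
    mul_count_partition _ j
  rcases Nat.eq_zero_or_pos j with rfl | hj
  · rw [Multiset.count_eq_zero.2 fun h => lt_irrefl _ ((cyclePartition _).parts_pos h), eq_comm,
      Multiset.count_eq_zero, Multiset.mem_cons, not_or]
    exact ⟨by omega, fun h => lt_irrefl _
      ((cyclePartition g).parts_pos (Multiset.mem_of_mem_erase h))⟩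
  have hsame : #{z | g.SameCycle z y} = l := by
    rw [hl, orbitCard]
    congr 1
    ext z
    simp [Perm.sameCycle_comm]
  -- The `l` letters of the orbit of `y` leave size `l` and, together with 0, form an orbit of size
  -- `l + 1`. The corrections are added on opposite sides to avoid truncated subtraction.
  have hsum : #{z | orbitCard (insertZero g y) z = j} + (if l = j then l else 0) =
      #{z | orbitCard g z = j} + if l + 1 = j then l + 1 else 0 := by
    rw [card_filter, Fin.sum_univ_succ]
    simp only [orbitCard_insertZero_zero, orbitCard_insertZero_succ, ← hl]
    have h1 : ∀ z, (if orbitCard g z + (if g.SameCycle z y then 1 else 0) = j then 1 else 0) +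
        (if l = j then (if g.SameCycle z y then 1 else 0) else 0) =
        (if orbitCard g z = j then 1 else 0) +
          (if l + 1 = j then (if g.SameCycle z y then 1 else 0) else 0) := by
      intro z
      by_cases hz : g.SameCycle z y
      · rw [orbitCard_eq_of_sameCycle hz, ← hl]
        simp only [hz, if_true]
        omega
      · simp [hz]
    have h2 := sum_congr (s₁ := univ) rfl fun z _ => h1 z
    rw [sum_add_distrib, sum_add_distrib, ← card_filter (fun z => orbitCard g z = j)] at h2
    have h3 : ∀ c : Prop, [Decidable c] →
        (∑ z, if c then (if g.SameCycle z y then 1 else 0) else 0) = if c then l else 0 := by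
      intro c _
      split_ifs
      · rw [← card_filter, hsame]
      · simp
    rw [h3, h3] at h2
    split_ifs at h2 ⊢ <;> omega
  rw [← hnew, ← hold] at hsum
  refine Nat.eq_of_mul_eq_mul_left hj ?_
  have hcons : ((cyclePartition g).parts).count j =
      ((cyclePartition g).parts.erase l).count j + if j = l then 1 else 0 := by
    conv_lhs => rw [← Multiset.cons_erase hmem]
    rw [Multiset.count_cons]
  rw [Multiset.count_cons, mul_add]
  rw [hcons, mul_add] at hsum
  by_cases h1 : j = l
  · subst h1
    simp at hsum ⊢
    omega
  · by_cases h2 : j = l + 1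
    · subst h2
      simp at hsum ⊢
      omega
    · simp [h1, h2, Ne.symm h1, Ne.symm h2] at hsum ⊢
      omega

end

/-! ### Signs, long cycles and passage to one more letter -/

section
variable {n : ℕ}

theorem cyclePartition_conj (g τ : Perm (Fin n)) :
    cyclePartition (τ * g * τ⁻¹) = cyclePartition g := by
  ext1
  change (τ * g * τ⁻¹).partition.parts = g.partition.parts
  rw [Perm.partition_eq_of_isConj.1 (isConj_iff.2 ⟨τ, rfl⟩ : IsConj g (τ * g * τ⁻¹))]

theorem sign_eq_neg_one_pow (g : Perm (Fin n)) :
    Perm.sign g = (-1) ^ (n + partLength (cyclePartition g)) := by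
  have hparts : (cyclePartition g).parts = _ := Perm.parts_partition (σ := g)
  have hsum := (cyclePartition g).parts_sum
  rw [partLength, hparts, Perm.sign_of_cycleType]
  rw [hparts, Multiset.sum_add, Multiset.sum_replicate] at hsum
  rw [Multiset.card_add, Multiset.card_replicate]
  set k := Fintype.card (Fin n) - #g.support
  have : n + (g.cycleType.card + k) = g.cycleType.sum + g.cycleType.card + 2 * k := by
    simp only [smul_eq_mul, mul_one] at hsum
    omega
  rw [this, pow_add _ _ (2 * k), pow_mul]
  simp

theorem isLongCycle_iff (g : Perm (Fin n)) (hn : 1 ≤ n) : IsLongCycle g ↔ IsFullCycle g := by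
  have hcount : n * (cyclePartition g).parts.count n = #{z | orbitCard g z = n} :=
    mul_count_partition g n
  rw [isFullCycle_iff_sameCycle]
  constructor
  · intro h x y
    rw [IsLongCycle] at h
    rw [h, Multiset.count_singleton_self, mul_one] at hcount
    have h1 : univ.filter (fun z => orbitCard g z = n) = univ :=
      eq_univ_of_card _ (by rw [← hcount, Fintype.card_fin])
    have hx : orbitCard g x = n := by
      have : x ∈ univ.filter (fun z => orbitCard g z = n) := by rw [h1]; exact mem_univ x
      simpa using this
    have h2 : univ.filter (fun w => g.SameCycle x w) = univ :=
      eq_univ_of_card _ (by rw [Fintype.card_fin]; exact hx)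
    have : y ∈ univ.filter (fun w => g.SameCycle x w) := by rw [h2]; exact mem_univ y
    simpa using this
  · intro h
    have h1 : orbitCard g ⟨0, hn⟩ = n := by
      rw [orbitCard, filter_true_of_mem fun w _ => h _ w, card_univ, Fintype.card_fin]
    have hmem : n ∈ (cyclePartition g).parts := by
      have := orbitCard_mem_partition g ⟨0, hn⟩
      rwa [h1] at this
    have hsum := Multiset.sum_erase hmem
    rw [(cyclePartition g).parts_sum] at hsum
    have hz : (cyclePartition g).parts.erase n = 0 := by
      refine Multiset.eq_zero_of_forall_notMem fun a ha => ?_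
      have h2 := Multiset.single_le_sum (fun x _ => Nat.zero_le x) a ha
      have h3 := (cyclePartition g).parts_pos (Multiset.mem_of_mem_erase ha)
      omega
    rw [IsLongCycle, ← Multiset.cons_erase hmem, hz]
    rfl

/-- The permutation of `Fin (n + 1)` fixing `0` and acting as `s` on successors. -/
def fixZero (s : Perm (Fin n)) : Perm (Fin (n + 1)) := Perm.decomposeFin.symm (0, s)

theorem fixZero_zero (s : Perm (Fin n)) : fixZero s 0 = 0 := by
  simp [fixZero]

theorem fixZero_succ (s : Perm (Fin n)) (z : Fin n) : fixZero s z.succ = (s z).succ := by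
  simp [fixZero]

/-- Left multiplication by a permutation fixing 0 carries the insertion point along; this turns
marked pairs into factorizations. -/
theorem fixZero_mul_insertZero (s t : Perm (Fin n)) (y : Fin n) :
    fixZero s * insertZero t y = insertZero (s * t) (s y) := by
  ext1 z
  induction z using Fin.cases with
  | zero => simp [insertZero_zero, fixZero_succ]
  | succ z =>
    simp only [Perm.mul_apply, insertZero_succ, s.injective.eq_iff]
    split_ifs
    · rw [fixZero_zero]
    · rw [fixZero_succ]

theorem isNearCycle_fixZero (s : Perm (Fin n)) : IsNearCycle (fixZero s) 0 ↔ IsFullCycle s := by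
  constructor
  · intro h J hJ hc
    have := h.2 (J.map (Fin.succEmb n)) (by simp [Fin.succ_ne_zero]) (hJ.map) (by
      intro y hy
      obtain ⟨z, hz, rfl⟩ := mem_map.1 hy
      exact mem_map.2 ⟨s z, hc z hz, (fixZero_succ s z).symm⟩)
    ext z
    have hz : z.succ ∈ J.map (Fin.succEmb n) := by
      rw [this]
      exact mem_erase.2 ⟨Fin.succ_ne_zero z, mem_univ _⟩
    obtain ⟨w, hw, e⟩ := mem_map.1 hz
    simpa [← Fin.succ_injective _ e] using hw
  · intro h
    refine ⟨fixZero_zero s, fun J h0 hJ hc => ?_⟩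
    have := h (univ.filter fun z => z.succ ∈ J) (by
      obtain ⟨y, hy⟩ := hJ
      induction y using Fin.cases with
      | zero => exact absurd hy h0
      | succ z => exact ⟨z, by simpa using hy⟩) (by
      intro z hz
      have := hc z.succ (by simpa using hz)
      rw [fixZero_succ] at this
      simpa using this)
    ext y
    induction y using Fin.cases with
    | zero => simpa using h0
    | succ z =>
      have hz : z ∈ univ.filter fun z : Fin n => z.succ ∈ J := by rw [this]; exact mem_univ z
      simpa [Fin.succ_ne_zero] using hz

theorem isFullCycle_insertZero (t : Perm (Fin n)) (y : Fin n) :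
    IsFullCycle (insertZero t y) ↔ IsFullCycle t := by
  simp only [isFullCycle_iff_sameCycle, sameCycle_insertZero]
  exact ⟨fun h a b => h a.succ b.succ, fun h a b => h _ _⟩

theorem exists_insertZero {T : Perm (Fin (n + 1))} (hn : 1 ≤ n) (hT : IsFullCycle T) :
    ∃ t y, insertZero t y = T := by
  have h0 : T 0 ≠ 0 := by
    intro h
    have : (⟨1, by omega⟩ : Fin (n + 1)) ∈ ({0} : Finset (Fin (n + 1))) := by
      rw [hT {0} (by simp) (by simpa using h)]
      exact mem_univ _
    simp [Fin.ext_iff] at this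
  obtain ⟨y, hy⟩ := Fin.exists_succ_eq.2 h0
  refine ⟨(Perm.decomposeFin T).2, y, ?_⟩
  rw [insertZero, Equiv.symm_apply_eq]
  refine Prod.ext ?_ rfl
  have := Perm.decomposeFin_symm_apply_zero (Perm.decomposeFin T).1 (Perm.decomposeFin T).2
  rw [Prod.mk.eta, Equiv.symm_apply_apply] at this
  exact hy.trans this

theorem exists_fixZero {s : Perm (Fin (n + 1))} (hs : s 0 = 0) : ∃ s₀, fixZero s₀ = s := by
  refine ⟨(Perm.decomposeFin s).2, ?_⟩
  rw [fixZero, Equiv.symm_apply_eq]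
  refine Prod.ext ?_ rfl
  have := Perm.decomposeFin_symm_apply_zero (Perm.decomposeFin s).1 (Perm.decomposeFin s).2
  rw [Prod.mk.eta, Equiv.symm_apply_apply] at this
  exact hs.symm.trans this

theorem fixZero_injective : Function.Injective (fixZero : Perm (Fin n) → _) := fun s t h => by
  simpa [fixZero] using h

theorem insertZero_inj {s t : Perm (Fin n)} {x y : Fin n} :
    insertZero s x = insertZero t y ↔ s = t ∧ x = y := by
  simp [insertZero, and_comm]

open Classical in
-- A full cycle on one more letter arises uniquely by insertion before one of the old letters.
theorem card_isFullCycle (n : ℕ) : #{t : Perm (Fin (n + 1)) | IsFullCycle t} = n.factorial := by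
  induction n with
  | zero =>
    rw [filter_true_of_mem fun t _ => ?_]
    · simp
    · rw [isFullCycle_iff_sameCycle]
      intro x y
      rw [show x = y from Fin.ext (by omega)]
  | succ n ih =>
    rw [Nat.factorial_succ, ← ih, mul_comm]
    have : #((univ.filter fun t : Perm (Fin (n + 1)) => IsFullCycle t) ×ˢ
        (univ : Finset (Fin (n + 1)))) = #{t : Perm (Fin (n + 1)) | IsFullCycle t} * (n + 1) := by
      rw [card_product, card_univ, Fintype.card_fin]
    rw [← this, eq_comm]
    refine card_bij (fun p _ => insertZero p.1 p.2) ?_ ?_ ?_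
    · intro p hp
      simpa [isFullCycle_insertZero] using hp
    · intro p _ q _ h
      exact Prod.ext_iff.2 (insertZero_inj.1 h)
    · intro T hT
      have hT : IsFullCycle T := by simpa using hT
      obtain ⟨t, y, rfl⟩ := exists_insertZero (by omega) hT
      exact ⟨(t, y), by simpa [isFullCycle_insertZero] using hT, rfl⟩

open Classical in
theorem card_isNearCycle (hn : 1 ≤ n) :
    #{s : Perm (Fin (n + 1)) | IsNearCycle s 0} = (n - 1).factorial := by
  obtain ⟨k, rfl⟩ : ∃ k, n = k + 1 := ⟨n - 1, by omega⟩
  rw [Nat.add_sub_cancel, ← card_isFullCycle k, eq_comm]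
  refine card_bij (fun s _ => fixZero s) ?_ (fun s _ t _ h => fixZero_injective h) ?_
  · intro s hs
    simpa [isNearCycle_fixZero] using hs
  · intro s hs
    have hs : IsNearCycle s 0 := by simpa using hs
    obtain ⟨t, rfl⟩ := exists_fixZero hs.1
    exact ⟨t, by simpa [isNearCycle_fixZero] using hs, rfl⟩

set_option synthInstance.maxHeartbeats 400000 in
set_option synthInstance.maxSize 2000 in
set_option maxRecDepth 4000 in
-- The general count needs three letters. On two, the identity paired with either fixed point gives
-- the required two factorizations.
theorem isNearCycle_and_isFullCycle_fin_two : ∀ u : Perm (Fin (1 + 1)), Perm.sign u = -1 →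
    ∀ p : Fin (1 + 1) × Perm (Fin (1 + 1)),
      (IsNearCycle p.2 p.1 ∧ IsFullCycle (p.2⁻¹ * u)) ↔ p.2 = 1 := by
  unfold IsNearCycle IsFullCycle
  decide

open Classical in
/-- An odd permutation of `n + 1` letters is in exactly `2 (n - 1)!` ways the product of an
`n`-cycle with a chosen fixed point and an `(n + 1)`-cycle. -/
theorem card_factorizations (hn : 1 ≤ n) (u : Perm (Fin (n + 1))) (hu : Perm.sign u = -1) :
    #{p : Fin (n + 1) × Perm (Fin (n + 1)) | IsNearCycle p.2 p.1 ∧ IsFullCycle (p.2⁻¹ * u)} =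
      2 * (n - 1).factorial := by
  rcases hn.eq_or_lt with rfl | hn
  · rw [filter_congr fun p _ => isNearCycle_and_isFullCycle_fin_two u hu p, card_filter, ← univ_product_univ, sum_product]
    simp
  · have h := card_near_mul_full (by rw [Fintype.card_fin]; omega) 0 u
    rw [card_isNearCycle hn.le, hu] at h
    push_cast at h
    zify
    rw [h]
    ring

end

/-! ### Marked pairs and double counting -/

section
variable {n : ℕ}

/-- Triples of two long cycles `s`, `t` and a letter `y` such that inserting a new letter before
`y` in the cycle of `s * t` yields cycle-type `lam`. -/
def markedLongPairs (lam : (n + 1).Partition) : Finset ((Perm (Fin n) × Perm (Fin n)) × Fin n) :=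
  univ.filter fun x => IsLongCycle x.1.1 ∧ IsLongCycle x.1.2 ∧
    cyclePartition (insertZero (x.1.1 * x.1.2) x.2) = lam

open Classical in
theorem card_markedLongPairs (hn : 1 ≤ n) (lam : (n + 1).Partition) :
    #(markedLongPairs lam) = #{p : Perm (Fin (n + 1)) × Perm (Fin (n + 1)) |
      IsNearCycle p.1 0 ∧ IsFullCycle p.2 ∧ cyclePartition (p.1 * p.2) = lam} := by
  refine card_bij (fun x _ => (fixZero x.1.1, insertZero x.1.2 (x.1.1⁻¹ x.2))) ?_ ?_ ?_
  · rintro ⟨⟨s, t⟩, y⟩ hx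
    simp only [markedLongPairs, isLongCycle_iff _ hn, mem_filter, mem_univ, true_and] at hx ⊢
    rw [isNearCycle_fixZero, isFullCycle_insertZero, fixZero_mul_insertZero]
    simpa using hx
  · rintro ⟨⟨s, t⟩, y⟩ _ ⟨⟨s', t'⟩, y'⟩ _ h
    obtain ⟨h1, h2⟩ := Prod.ext_iff.1 h
    obtain rfl : s = s' := fixZero_injective h1
    obtain ⟨rfl, h3⟩ := insertZero_inj.1 h2
    obtain rfl : y = y' := (s⁻¹).injective h3
    rfl
  · rintro ⟨S, T⟩ h
    simp only [mem_filter, mem_univ, true_and] at h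
    obtain ⟨hS, hT, hST⟩ := h
    obtain ⟨s, rfl⟩ := exists_fixZero hS.1
    obtain ⟨t, y, rfl⟩ := exists_insertZero hn hT
    refine ⟨((s, t), s y), ?_, by simp⟩
    simp only [markedLongPairs, isLongCycle_iff _ hn, mem_filter, mem_univ, true_and]
    rw [isNearCycle_fixZero] at hS
    rw [isFullCycle_insertZero] at hT
    rw [fixZero_mul_insertZero] at hST
    exact ⟨hS, hT, hST⟩

open Classical in
-- Count triples (fixed point, near-cycle, full cycle) with product of type `lam` twice: by the
-- fixed point, which conjugation moves to 0, and by the product, using `card_factorizations`.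
theorem mul_card_markedLongPairs (hn : 1 ≤ n) (lam : (n + 1).Partition)
    (hlam : partLength lam ≡ n [MOD 2]) :
    (n + 1) * #(markedLongPairs lam) = 2 * (n - 1).factorial * numOfType lam := by
  rw [card_markedLongPairs hn]
  set A := univ.filter fun x : Fin (n + 1) × (Perm (Fin (n + 1)) × Perm (Fin (n + 1))) =>
    IsNearCycle x.2.1 x.1 ∧ IsFullCycle x.2.2 ∧ cyclePartition (x.2.1 * x.2.2) = lam with hA
  have hleft : #A = (n + 1) * #{p : Perm (Fin (n + 1)) × Perm (Fin (n + 1)) |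
      IsNearCycle p.1 0 ∧ IsFullCycle p.2 ∧ cyclePartition (p.1 * p.2) = lam} := by
    rw [hA, card_filter, ← univ_product_univ, sum_product]
    simp only [← card_filter]
    rw [sum_congr rfl (g := fun _ => #{p : Perm (Fin (n + 1)) × Perm (Fin (n + 1)) |
      IsNearCycle p.1 0 ∧ IsFullCycle p.2 ∧ cyclePartition (p.1 * p.2) = lam}), sum_const,
      card_univ, Fintype.card_fin, smul_eq_mul]
    intro a _
    have hconj : ∀ b c : Fin (n + 1), ∀ p : Perm (Fin (n + 1)) × Perm (Fin (n + 1)),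
        (IsNearCycle p.1 b ∧ IsFullCycle p.2 ∧ cyclePartition (p.1 * p.2) = lam) →
        (IsNearCycle (swap b c * p.1 * (swap b c)⁻¹) c ∧
          IsFullCycle (swap b c * p.2 * (swap b c)⁻¹) ∧
          cyclePartition (swap b c * p.1 * (swap b c)⁻¹ * (swap b c * p.2 * (swap b c)⁻¹)) =
            lam) := by
      rintro b c p ⟨h1, h2, h3⟩
      refine ⟨?_, h2.conj _, ?_⟩
      · have := h1.conj (swap b c)
        rwa [swap_apply_left] at this
      · rw [← h3, ← cyclePartition_conj (p.1 * p.2) (swap b c)]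
        congr 1
        group
    refine card_nbij' (fun p => (swap a 0 * p.1 * (swap a 0)⁻¹, swap a 0 * p.2 * (swap a 0)⁻¹))
      (fun p => (swap 0 a * p.1 * (swap 0 a)⁻¹, swap 0 a * p.2 * (swap 0 a)⁻¹)) ?_ ?_ ?_ ?_
    · intro p hp
      simp only [coe_filter, mem_univ, true_and, Set.mem_ofPred_eq] at hp ⊢
      exact hconj a 0 p hp
    · intro p hp
      simp only [coe_filter, mem_univ, true_and, Set.mem_ofPred_eq] at hp ⊢
      exact hconj 0 a p hp
    · intro p _
      simp [mul_assoc, swap_comm a 0]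
    · intro p _
      simp [mul_assoc, swap_comm a 0]
  have hright : #A = 2 * (n - 1).factorial * numOfType lam := by
    rw [numOfType, card_eq_sum_card_fiberwise (s := A) (f := fun x => x.2.1 * x.2.2)
      (t := univ.filter fun σ => cyclePartition σ = lam)]
    · rw [sum_congr rfl (g := fun _ => 2 * (n - 1).factorial), sum_const, smul_eq_mul, mul_comm]
      intro u hu
      have hu : cyclePartition u = lam := by simpa using hu
      -- The sign exponent is `n + 1` plus the length, which is odd since the length has the parity
      -- of `n`.
      have hsign : Perm.sign u = -1 := by
        rw [sign_eq_neg_one_pow, hu]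
        refine Odd.neg_one_pow ?_
        rw [Nat.odd_iff]
        have := hlam
        unfold Nat.ModEq at this
        omega
      rw [← card_factorizations hn u hsign]
      refine card_nbij' (fun x => (x.1, x.2.1)) (fun p => (p.1, (p.2, p.2⁻¹ * u))) ?_ ?_ ?_ ?_
      · rintro ⟨a, s, T⟩ hx
        simp only [hA, filter_filter, coe_filter, mem_univ, true_and, Set.mem_ofPred_eq] at hx ⊢
        obtain ⟨⟨h1, h2, h3⟩, rfl⟩ := hx
        exact ⟨h1, by simpa using h2⟩
      · rintro ⟨a, s⟩ hp
        simp only [hA, filter_filter, coe_filter, mem_univ, true_and, Set.mem_ofPred_eq] at hp ⊢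
        exact ⟨⟨hp.1, hp.2, by simpa using hu⟩, by simp⟩
      · rintro ⟨a, s, T⟩ hx
        simp only [hA, filter_filter, coe_filter, mem_univ, true_and, Set.mem_ofPred_eq] at hx
        obtain ⟨-, rfl⟩ := hx
        simp
      · intro p _
        rfl
    · intro x hx
      simp only [hA, coe_filter, mem_univ, true_and, Set.mem_ofPred_eq] at hx ⊢
      exact hx.2.2
  rw [← hleft, hright]

theorem cyclePartition_insertZero_eq_iff (g : Perm (Fin n)) (y : Fin n) (lam : (n + 1).Partition)
    (i : ℕ) (hi : i ∈ lowerIndices lam) (h : orbitCard g y = i) :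
    cyclePartition (insertZero g y) = lam ↔ cyclePartition g = lowerPart lam i hi := by
  have hmem : i ∈ (cyclePartition g).parts := h ▸ orbitCard_mem_partition g y
  have hmem' : i + 1 ∈ lam.parts := (mem_filter.1 hi).2
  rw [Nat.Partition.ext_iff, Nat.Partition.ext_iff, parts_insertZero, h]
  change _ ↔ _ = i ::ₘ lam.parts.erase (i + 1)
  constructor
  · intro e
    rw [← e, Multiset.erase_cons_head, Multiset.cons_erase hmem]
  · intro e
    rw [e, Multiset.erase_cons_head, Multiset.cons_erase hmem']

theorem orbitCard_mem_lowerIndices (g : Perm (Fin n)) (y : Fin n) :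
    orbitCard g y ∈ lowerIndices (cyclePartition (insertZero g y)) := by
  refine mem_filter.2 ⟨mem_Icc.2 ⟨orbitCard_pos g y, ?_⟩, ?_⟩
  · exact (card_le_univ _).trans_eq (Fintype.card_fin n)
  · rw [parts_insertZero]
    exact Multiset.mem_cons_self _ _

/-- Sort marked pairs by the size `i` of the orbit of the mark: type `lam` after insertion means
type `lowerPart lam i` before, and `i * m_i` letters can be marked. -/
theorem sum_lowerPart (lam : (n + 1).Partition) :
    ∑ i ∈ (lowerIndices lam).attach,
      (i : ℕ) * partMult (lowerPart lam i i.2) i * numLongPairs (lowerPart lam i i.2) =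
        #(markedLongPairs lam) := by
  have hmaps : ∀ x ∈ markedLongPairs lam, orbitCard (x.1.1 * x.1.2) x.2 ∈ lowerIndices lam := by
    intro x hx
    have hx := (mem_filter.1 hx).2.2.2
    exact hx ▸ orbitCard_mem_lowerIndices _ _
  rw [card_eq_sum_card_fiberwise hmaps, ← sum_attach (lowerIndices lam)]
  refine sum_congr rfl fun i _ => ?_
  rw [numLongPairs, card_eq_sum_card_fiberwise
    (s := (markedLongPairs lam).filter fun x => orbitCard (x.1.1 * x.1.2) x.2 = i)
    (f := fun x => x.1)
    (t := univ.filter fun st : Perm (Fin n) × Perm (Fin n) =>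
      IsLongCycle st.1 ∧ IsLongCycle st.2 ∧ cyclePartition (st.1 * st.2) = lowerPart lam i i.2)]
  · rw [sum_congr rfl (g := fun _ => (i : ℕ) * partMult (lowerPart lam i i.2) i), sum_const,
      smul_eq_mul, mul_comm]
    rintro st hst
    obtain ⟨h1, h2, h3⟩ := (mem_filter.1 hst).2
    have : (i : ℕ) * partMult (lowerPart lam i i.2) i =
        #{z | orbitCard (st.1 * st.2) z = (i : ℕ)} := by
      rw [← mul_count_partition, ← h3]
      rfl
    rw [this]
    refine card_nbij' (fun x => x.2) (fun z => (st, z)) ?_ ?_ ?_ ?_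
    · rintro x hx
      simp only [coe_filter, mem_filter, Set.mem_ofPred_eq, mem_univ, true_and] at hx ⊢
      obtain ⟨⟨-, hx⟩, rfl⟩ := hx
      exact hx
    · intro z hz
      simp only [coe_filter, mem_filter, Set.mem_ofPred_eq, mem_univ, true_and,
        markedLongPairs] at hz ⊢
      exact ⟨⟨⟨h1, h2, (cyclePartition_insertZero_eq_iff _ z lam i i.2 hz).2 h3⟩, hz⟩, trivial⟩
    · rintro x hx
      simp only [coe_filter, mem_filter, Set.mem_ofPred_eq] at hx
      obtain ⟨-, rfl⟩ := hx
      rfl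
    · intro z _
      rfl
  · intro x hx
    simp only [coe_filter, mem_filter, Set.mem_ofPred_eq, mem_univ, true_and,
      markedLongPairs] at hx ⊢
    obtain ⟨⟨h1, h2, h3⟩, h4⟩ := hx
    exact ⟨h1, h2, (cyclePartition_insertZero_eq_iff _ _ lam i i.2 h4).1 h3⟩

theorem partLength_insertZero (g : Perm (Fin n)) (y : Fin n) :
    partLength (cyclePartition (insertZero g y)) = partLength (cyclePartition g) := by
  have hmem : orbitCard g y ∈ (cyclePartition g).parts := orbitCard_mem_partition g y
  rw [partLength, parts_insertZero, Multiset.card_cons, Multiset.card_erase_add_one hmem]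
  rfl

/-- Insertion preserves the number of cycles, so each pair is counted once for each of its `n`
marks. -/
theorem sum_card_markedLongPairs (m : ℕ) :
    ∑ lam : (n + 1).Partition with partLength lam = m, #(markedLongPairs lam) =
      n * #{st : Perm (Fin n) × Perm (Fin n) | IsLongCycle st.1 ∧ IsLongCycle st.2 ∧
        partLength (cyclePartition (st.1 * st.2)) = m} := by
  have h : #((univ.filter fun st : Perm (Fin n) × Perm (Fin n) => IsLongCycle st.1 ∧
      IsLongCycle st.2 ∧ partLength (cyclePartition (st.1 * st.2)) = m) ×ˢ
      (univ : Finset (Fin n))) = n * #{st : Perm (Fin n) × Perm (Fin n) | IsLongCycle st.1 ∧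
        IsLongCycle st.2 ∧ partLength (cyclePartition (st.1 * st.2)) = m} := by
    rw [card_product, card_univ, Fintype.card_fin, mul_comm]
  rw [← h, card_eq_sum_card_fiberwise
    (f := fun x => cyclePartition (insertZero (x.1.1 * x.1.2) x.2))
    (t := univ.filter fun lam : (n + 1).Partition => partLength lam = m)]
  · refine sum_congr rfl fun lam hlam => ?_
    have hlam : partLength lam = m := by simpa using hlam
    congr 1
    ext x
    simp only [markedLongPairs, mem_filter, mem_product, mem_univ, true_and, and_true]
    constructor
    · rintro ⟨h1, h2, h3⟩
      exact ⟨⟨h1, h2, by rw [← partLength_insertZero _ x.2, h3, hlam]⟩, h3⟩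
    · rintro ⟨⟨h1, h2, -⟩, h3⟩
      exact ⟨h1, h2, h3⟩
  · intro x hx
    simp only [coe_filter, coe_product, Set.mem_prod, Set.mem_ofPred_eq, mem_univ, true_and,
      partLength_insertZero] at hx ⊢
    exact hx.1.2.2

theorem sum_numOfType (m : ℕ) :
    ∑ lam : n.Partition with partLength lam = m, numOfType lam = numWithCycles n m := by
  rw [numWithCycles, card_eq_sum_card_fiberwise (f := cyclePartition)
    (t := univ.filter fun lam : n.Partition => partLength lam = m)]
  · refine sum_congr rfl fun lam hlam => ?_
    have hlam : partLength lam = m := by simpa using hlam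
    rw [numOfType, filter_filter]
    congr 1
    ext σ
    simp only [mem_filter, mem_univ, true_and]
    exact ⟨fun h => ⟨by rw [h, hlam], h⟩, fun h => h.2⟩
  · intro σ hσ
    simpa using hσ

theorem isLongCycle_finRotate (hn : 1 ≤ n) : IsLongCycle (finRotate n) := by
  rcases hn.eq_or_lt with rfl | hn
  · decide
  · obtain ⟨k, rfl⟩ : ∃ k, n = k + 2 := ⟨n - 2, by omega⟩
    change (finRotate (k + 2)).partition.parts = _
    rw [Perm.parts_partition, cycleType_finRotate, support_finRotate]
    simp

theorem isLongCycle_conj (g τ : Perm (Fin n)) : IsLongCycle (τ * g * τ⁻¹) ↔ IsLongCycle g := by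
  rw [IsLongCycle, IsLongCycle, cyclePartition_conj]

theorem IsLongCycle.isConj {g h : Perm (Fin n)} (hg : IsLongCycle g) (hh : IsLongCycle h) :
    IsConj g h := by
  rw [Perm.partition_eq_of_isConj]
  ext1
  exact Eq.trans hg (Eq.symm hh)

/-- Simultaneous conjugation moves the first factor to `finRotate n`, and there are `(n - 1)!`
choices of that factor. -/
theorem card_longPairs (hn : 1 ≤ n) (m : ℕ) :
    #{st : Perm (Fin n) × Perm (Fin n) | IsLongCycle st.1 ∧ IsLongCycle st.2 ∧
      partLength (cyclePartition (st.1 * st.2)) = m} =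
    (n - 1).factorial * #{s : Perm (Fin n) | IsLongCycle s ∧
      partLength (cyclePartition (finRotate n * s)) = m} := by
  have hcard : #{g : Perm (Fin n) | IsLongCycle g} = (n - 1).factorial := by
    classical
    obtain ⟨k, rfl⟩ : ∃ k, n = k + 1 := ⟨n - 1, by omega⟩
    rw [Nat.add_sub_cancel, ← card_isFullCycle k]
    congr 1
    ext g
    simp [isLongCycle_iff g hn]
  rw [← hcard, card_eq_sum_card_fiberwise (f := fun st : Perm (Fin n) × Perm (Fin n) => st.1)
    (t := univ.filter fun g => IsLongCycle g)]
  · rw [sum_congr rfl (g := fun _ => #{s : Perm (Fin n) | IsLongCycle s ∧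
      partLength (cyclePartition (finRotate n * s)) = m}), sum_const, smul_eq_mul]
    intro g hg
    have hg : IsLongCycle g := by simpa using hg
    obtain ⟨τ, hτ⟩ := isConj_iff.1 (hg.isConj (isLongCycle_finRotate hn))
    refine card_nbij' (fun st => τ * st.2 * τ⁻¹) (fun s => (g, τ⁻¹ * s * τ)) ?_ ?_ ?_ ?_
    · rintro ⟨g', s⟩ h
      simp only [filter_filter, coe_filter, mem_univ, true_and, Set.mem_ofPred_eq] at h ⊢
      obtain ⟨⟨-, h2, h3⟩, rfl⟩ := h
      refine ⟨(isLongCycle_conj _ _).2 h2, ?_⟩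
      rw [← h3, ← cyclePartition_conj (g' * s) τ, ← hτ]
      congr 2
      group
    · intro s h
      simp only [filter_filter, coe_filter, mem_univ, true_and, Set.mem_ofPred_eq] at h ⊢
      refine ⟨⟨hg, ?_, ?_⟩, trivial⟩
      · rw [← isLongCycle_conj _ τ]
        simpa [mul_assoc] using h.1
      · rw [← h.2, ← cyclePartition_conj _ τ, ← hτ]
        congr 2
        group
    · rintro ⟨g', s⟩ h
      simp only [filter_filter, coe_filter, mem_univ, true_and, Set.mem_ofPred_eq] at h
      obtain ⟨-, rfl⟩ := h
      simp [mul_assoc]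
    · intro s _
      simp [mul_assoc]
  · intro st h
    simp only [coe_filter, mem_univ, true_and, Set.mem_ofPred_eq] at h ⊢
    exact h.1

end

theorem theorem1 (m n : ℕ) (hn : 1 ≤ n) (hmn : m ≡ n [MOD 2]) :
    (∀ lam : (n + 1).Partition, partLength lam = m →
      ((n : ℚ) + 1) / 2 *
          ∑ i ∈ (lowerIndices lam).attach,
            ((i : ℕ) : ℚ) * (partMult (lowerPart lam i i.2) i : ℚ) *
              (numLongPairs (lowerPart lam i i.2) : ℚ) =
        (Nat.factorial (n - 1) : ℚ) * (numOfType lam : ℚ)) ∧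
    (((Finset.univ.filter fun s : Equiv.Perm (Fin n) =>
          IsLongCycle s ∧ partLength (cyclePartition (finRotate n * s)) = m).card : ℕ) : ℚ) =
      2 / ((n : ℚ) * ((n : ℚ) + 1)) * (numWithCycles (n + 1) m : ℚ) := by
  have hmain : ∀ lam : (n + 1).Partition, partLength lam = m →
      (n + 1) * #(markedLongPairs lam) = 2 * (n - 1).factorial * numOfType lam :=
    fun lam hlam => mul_card_markedLongPairs hn lam (hlam ▸ hmn)
  constructor
  · intro lam hlam
    have h1 := congrArg (Nat.cast (R := ℚ)) (sum_lowerPart lam)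
    have h2 := congrArg (Nat.cast (R := ℚ)) (hmain lam hlam)
    push_cast at h1 h2
    rw [h1]
    linear_combination h2 / 2
  · have hsum : (n + 1) * (n * ((n - 1).factorial * #{s : Perm (Fin n) | IsLongCycle s ∧
        partLength (cyclePartition (finRotate n * s)) = m})) =
        2 * (n - 1).factorial * numWithCycles (n + 1) m := by
      rw [← card_longPairs hn, ← sum_card_markedLongPairs, ← sum_numOfType, mul_sum, mul_sum]
      exact sum_congr rfl fun lam hlam => hmain lam (by simpa using hlam)
    have h := congrArg (Nat.cast (R := ℚ)) hsum
    push_cast at h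
    have hf : ((n - 1).factorial : ℚ) ≠ 0 := by exact_mod_cast Nat.factorial_ne_zero _
    have hn0 : (n : ℚ) ≠ 0 := by exact_mod_cast (by omega : n ≠ 0)
    have hn1 : (n : ℚ) + 1 ≠ 0 := by positivity
    rw [div_mul_eq_mul_div, eq_div_iff (mul_ne_zero hn0 hn1)]
    -- The factor `(n - 1)!` comes from the choice of first cycle on one side and from the
    -- factorization count on the other.
    refine mul_left_cancel₀ hf ?_
    linear_combination h
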